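/- **Model.** Ants move on $\mathbb{Z}^2$; all $k\ge 1$ ants start at the nest $(0,0)$, and no cell holds a pheromone at the start. All ants are copies of one deterministic finite-state machine. In one atomic step an ant senses whether its current cell holds a pheromone; depending only on this bit and on its state it chooses whether to emit a pheromone on its current cell, how to move (by one cell north, east, south or west, or not at all) and its next state; then it emits, moves and updates its state. An emitted pheromone stays forever. Ants do not communicate otherwise. An asynchronous schedule is an infinite sequence of ants, which make one step each in this order, in which every ant occurs infinitely often (no failures). A round ends as soon as every ant has taken at least one step in it. The search for a treasure at the cell $x=(x_1,x_2)$, at distance $D=|x_1|+|x_2|$, terminates when some ant reaches $x$. **Algorithm.** Each ant repeats forever: go(east), emit, go(west); go(south), emit, go(north); go(west), emit, go(east); go(north), emit; explore(east, south); explore(south, west); explore(west, north); explore(north, east); go(south). Here go($d$) makes a step in direction $d$ and repeats this while the cell reached holds a pheromone, and explore($d,d'$) makes alternate steps $d,d',d,d',\dots$ until the cell reached holds a pheromone. Sensing the pheromone-free cell that ends a go, emitting on this cell, and the move that follows are one atomic step. **Theorem.** There is an absolute constant $C$ such that the following hold for every integer $D\ge 0$. 1. (Time.) For every $k\ge1$,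 every treasure at distance $D$ and every asynchronous schedule of $k$ ants, the search terminates within $C\,(D+D^2/k)$ rounds. 2. (Bounded supply.) For every $k\ge 1$ and every $B\ge C\max(D,k)$ (that is, $B\ge CD$ if $k\le D$), if at most $B$ pheromones can be emitted in total (further attempts to emit have no effect, and the ants do not notice), then for every treasure at distance $D$ and every asynchronous schedule of $k$ ants the search still terminates within $C\,(D+D^2/k)$ rounds. 3. (Required amount, for any number of ants.) There is a finite set $S\subset\mathbb{Z}^2$, depending only on $D$, such that, if attempts to emit on cells outside $S$ have no effect (and the ants do not notice), then for every $k\ge1$, every treasure at distance $D$ and every asynchronous schedule of $k$ ants, at most $CD$ pheromones are ever emitted and the search still terminates within $C\,(D+D^2/k)$ rounds. -/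

import Mathlib

namespace AntSearch

/-- A cell of the infinite two-dimensional grid; `(0, 0)` is the nest. -/
abbrev Cell := ℤ × ℤ

/-- Manhattan distance from the nest. -/
def distNest (c : Cell) : ℕ := c.1.natAbs + c.2.natAbs

inductive Dir where
  | north | east | south | west

namespace Dir

/-- Unit step in a direction (the first coordinate grows eastwards, the second northwards). -/
def vec : Dir → Cell
  | north => (0, 1)
  | east => (1, 0)
  | south => (0, -1)
  | west => (-1, 0)

/-- The next direction in clockwise order. -/
def cw : Dir → Dir
  | north => east
  | east => south
  | south => west
  | west => north

/-- The opposite direction. -/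
def opp : Dir → Dir
  | north => south
  | east => west
  | south => north
  | west => east

end Dir

/-- What an ant does in one step: it may emit a pheromone on its current cell, then it moves to a
neighbouring cell (`some d`) or holds its position (`none`), and it updates its state. -/
structure Action (Q : Type) where
  emit : Bool
  move : Option Dir
  next : Q

/-- Displacement caused by an optional move. -/
def displacement : Option Dir → Cell
  | none => 0
  | some d => d.vec

/-- A deterministic finite-state ant.  The action depends only on the state and on whether a
pheromone is sensed on the current cell. -/
structure AntFSM where
  State : Type
  finite_state : Finite State
  start : State
  trans : State → Bool → Action State

/-- A global configuration of `k` ants running the machine `M`: positions and states of the ants,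
the set of cells that hold a pheromone, and the number of pheromones emitted so far. -/
structure Config (M : AntFSM) (k : ℕ) where
  pos : Fin k → Cell
  state : Fin k → M.State
  pheromones : Finset Cell
  emitted : ℕ

/-- A constraint on the emission of pheromones: `allow c n` says whether a pheromone can be emitted
on the cell `c` when `n` pheromones have been emitted before.  An attempted emission that is not
allowed has no effect, and the ant does not notice. -/
abbrev Supply := Cell → ℕ → Bool

/-- Every emission succeeds (the standard model). -/
def Supply.unlimited : Supply := fun _ _ => true

/-- At most `B` pheromones can be emitted in total. -/
def Supply.budget (B : ℕ) : Supply := fun _ n => decide (n < B)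

/-- Pheromones can be emitted only on the cells of `S`. -/
def Supply.onCells (S : Finset Cell) : Supply := fun c _ => decide (c ∈ S)

/-- All ants are in the nest, in the starting state, and there is no pheromone. -/
def initial (M : AntFSM) (k : ℕ) : Config M k where
  pos := fun _ => (0, 0)
  state := fun _ => M.start
  pheromones := ∅
  emitted := 0

/-- One atomic step of the ant `a`: it senses, decides, possibly emits on its current cell, moves,
and updates its state. -/
def Config.step {M : AntFSM} {k : ℕ} (allow : Supply) (c : Config M k) (a : Fin k) :
    Config M k :=
  let act := M.trans (c.state a) (decide (c.pos a ∈ c.pheromones))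
  let ok := act.emit && allow (c.pos a) c.emitted
  { pos := Function.update c.pos a (c.pos a + displacement act.move)
    state := Function.update c.state a act.next
    pheromones := if ok then insert (c.pos a) c.pheromones else c.pheromones
    emitted := if ok then c.emitted + 1 else c.emitted }

/-- The configuration after `t` steps of the asynchronous execution in which the `i`-th step
(counted from `0`) is made by the ant `σ i`. -/
def run (M : AntFSM) {k : ℕ} (allow : Supply) (σ : ℕ → Fin k) : ℕ → Config M k
  | 0 => initial M k
  | t + 1 => (run M allow σ t).step allow (σ t)

/-- Every ant is selected by the scheduler again and again. -/
def Fair {k : ℕ} (σ : ℕ → Fin k) : Prop := ∀ a t, ∃ s, t ≤ s ∧ σ s = a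

/-- `roundEnd σ r` is the number of steps after which the first `r` rounds are over: a round ends
as soon as every ant took at least one step in it. -/
noncomputable def roundEnd {k : ℕ} (σ : ℕ → Fin k) : ℕ → ℕ
  | 0 => 0
  | r + 1 => sInf {t | ∀ a, ∃ s, roundEnd σ r ≤ s ∧ s < t ∧ σ s = a}

/-- The search terminates successfully within `ρ` rounds: by the end of some round `r ≤ ρ`
an ant has reached the treasure. -/
def FindsWithin (M : AntFSM) {k : ℕ} (allow : Supply) (σ : ℕ → Fin k) (treasure : Cell) (ρ : ℝ) :
    Prop :=
  ∃ r : ℕ, (r : ℝ) ≤ ρ ∧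
    ∃ t, t ≤ roundEnd σ r ∧ ∃ a, (run M allow σ t).pos a = treasure

/-- Control states of the ray-extension and zig-zag algorithm.
* `out d`: in `go(d)`, away from the nest along the ray in direction `d`;
* `back d`: in `go(opp d)`, back to the nest along the ray in direction `d`;
* `zig d`, `zag d`: in the exploration of the quadrant that begins at the ray in direction `d`;
  if no pheromone is sensed, the next step is a zig, respectively a zag. -/
inductive SearchState where
  | out (d : Dir)
  | back (d : Dir)
  | zig (d : Dir)
  | zag (d : Dir)

theorem finite_searchState : Finite SearchState := by
  have hd : Finite Dir :=
    Finite.of_injective (β := Fin 4)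
      (fun d => match d with | .north => 0 | .east => 1 | .south => 2 | .west => 3)
      (by intro a b; cases a <;> cases b <;> simp)
  refine Finite.of_injective (β := Fin 4 × Dir)
    (fun q => match q with
      | .out d => (0, d) | .back d => (1, d) | .zig d => (2, d) | .zag d => (3, d)) ?_
  intro a b
  cases a <;> cases b <;> simp

open Dir SearchState in
/-- The transition function (the Boolean tells whether a pheromone is sensed) of the program

  while true:
    go(east), emit(), go(west)
    go(south), emit(), go(north)
    go(west), emit(), go(east)
    go(north), emit()
    explore(east, south)
    explore(south, west)
    explore(west, north)
    explore(north, east)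
    go(south)

where `go(d)` makes a step `d`, and repeats this while a pheromone is sensed on the cell reached,
and `explore(zig, zag)` makes the steps zig, zag, zig, zag, ... until a pheromone is sensed on the
cell reached.  The exploration that begins at the ray `d` is `explore(cw d, opp d)`. -/
def searchTrans : SearchState → Bool → Action SearchState
  | out d, true => ⟨false, some d, out d⟩
  | out north, false => ⟨true, some east, zag north⟩
  | out d, false => ⟨true, some d.opp, back d⟩
  | back d, true => ⟨false, some d.opp, back d⟩
  | back d, false => ⟨false, some d.cw, out d.cw⟩
  | zig d, false => ⟨false, some d.cw, zag d⟩
  | zag d, false => ⟨false, some d.opp, zig d⟩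
  | zig west, true => ⟨false, some south, back north⟩
  | zag west, true => ⟨false, some south, back north⟩
  | zig d, true => ⟨false, some d.cw.cw, zag d.cw⟩
  | zag d, true => ⟨false, some d.cw.cw, zag d.cw⟩

/-- The algorithm as a finite-state ant.  The starting state is the head of the loop: at the nest,
which is free of pheromones, `back north` goes on with `go(east)`. -/
def searchFSM : AntFSM where
  State := SearchState
  finite_state := finite_searchState
  start := SearchState.back Dir.north
  trans := searchTrans

end AntSearch

open AntSearch

/-! At all times the pheromones form four straight rays from the nest. Sensing and emitting are
atomic, so an attempt to emit always happens on the first free cell of a ray, and no cell is marked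
twice (`antInv_and_mem_pherAt`, `coord_of_attempts`). Each ant attempts the rays in cyclic order, so
its four counts differ by at most 1. Summed over ants, each ray gets at least as many attempts as
the northern one and at most `k` more (`total_le`).

Until the northern attempts exceed `D`, at most `4D + 3k` pheromones have been emitted. A supply
that allows emissions within distance `D` up to that number therefore never fails where it matters:
every ray is as long as its number of attempts, capped at `D`, and every exploration at distance `h`
finds all four rays of length at least `h` (`ray_ge_and_exploring`). Such an exploration takes at
most `8h` steps and meets every cell at distance `h`.

Hence in `O(D)` rounds every ant completes a cycle, or the total reaches `D` anyway, so the northern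
total grows by `k` up to the cap `D` (`min_add_le_total_north`). After `D/k + 1` such phases it is
at least `D`. The attempt that made it `D` started an exploration at distance `D`, which meets the
treasure within `8D` further rounds. All three claims are instances of `findsWithin_of_allow`; for
the third, `S` is the ball of radius `D`. -/

namespace AntSearch

open Dir SearchState

/-! ### Rays and the local invariants of a single ant. -/

/-- The component of a cell in direction `d`. -/
def coord : Dir → Cell → ℤ
  | north, c => c.2
  | east, c => c.1
  | south, c => -c.2
  | west, c => -c.1

/-- The cell `c` lies on one of the four rays from the nest, of lengths `ρ`. -/
def OnRays (ρ : Dir → ℕ) (c : Cell) : Prop :=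
  ∃ d, coord d.cw c = 0 ∧ 1 ≤ coord d c ∧ coord d c ≤ ρ d

theorem onRays_iff (ρ : Dir → ℕ) (c : Cell) : OnRays ρ c ↔
    (c.2 = 0 ∧ 1 ≤ c.1 ∧ c.1 ≤ ρ east) ∨ (c.1 = 0 ∧ 1 ≤ -c.2 ∧ -c.2 ≤ ρ south) ∨
      (c.2 = 0 ∧ 1 ≤ -c.1 ∧ -c.1 ≤ ρ west) ∨ (c.1 = 0 ∧ 1 ≤ c.2 ∧ c.2 ≤ ρ north) := by
  constructor
  · rintro ⟨d, h⟩
    cases d <;> simp only [coord, cw] at h <;> omega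
  · rintro (h | h | h | h)
    · exact ⟨east, by simp only [coord, cw]; omega⟩
    · exact ⟨south, by simp only [coord, cw]; omega⟩
    · exact ⟨west, by simp only [coord, cw]; omega⟩
    · exact ⟨north, by simp only [coord, cw]; omega⟩

/-- Where an ant can be, depending on its state, when the rays have lengths `ρ`. -/
def AntInv (ρ : Dir → ℕ) : SearchState → Cell → Prop
  | out d, c => coord d.cw c = 0 ∧ 1 ≤ coord d c ∧ coord d c ≤ ρ d + 1
  | back d, c => coord d.cw c = 0 ∧ 0 ≤ coord d c ∧ coord d c ≤ ρ d
  | zig d, c => 1 ≤ coord d.cw c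
  | zag d, c => 1 ≤ coord d.cw c

theorem AntInv.mono {ρ ρ' : Dir → ℕ} (h : ∀ d, ρ d ≤ ρ' d) {q : SearchState} {c : Cell}
    (hq : AntInv ρ q c) : AntInv ρ' q c := by
  rcases q with d | d | d | d <;> have := h d <;> simp only [AntInv] at * <;> omega

theorem AntInv.step {ρ : Dir → ℕ} {q : SearchState} {c : Cell} (hq : AntInv ρ q c) {b : Bool}
    (hb : b = true ↔ OnRays ρ c) :
    AntInv ρ (searchTrans q b).next (c + displacement (searchTrans q b).move) := by
  rw [onRays_iff] at hb
  obtain ⟨x, y⟩ := c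
  rcases q with d | d | d | d <;> cases d <;> cases b <;>
    simp [AntInv, searchTrans, displacement, vec, cw, opp, coord] at * <;> omega

/-- The numbers of attempts of one ant to extend the rays, depending on its state. -/
def CountInv (κ : Dir → ℕ) : SearchState → Prop
  | back east | out south => κ east = κ north + 1 ∧ κ south = κ north ∧ κ west = κ north
  | back south | out west => κ east = κ north + 1 ∧ κ south = κ north + 1 ∧ κ west = κ north
  | back west | out north =>
      κ east = κ north + 1 ∧ κ south = κ north + 1 ∧ κ west = κ north + 1
  | _ => κ east = κ north ∧ κ south = κ north ∧ κ west = κ north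

open Classical in
theorem CountInv.step {κ κ' : Dir → ℕ} {q : SearchState} (hq : CountInv κ q) (b : Bool)
    (hκ : ∀ d, κ' d = κ d + if q = out d ∧ b = false then 1 else 0) :
    CountInv κ' (searchTrans q b).next := by
  have h1 := hκ east
  have h2 := hκ south
  have h3 := hκ west
  have h4 := hκ north
  rcases q with d | d | d | d <;> cases d <;> cases b <;>
    simp [CountInv, searchTrans, cw, opp] at * <;> omega

/-! ### Exploration of the cells at a fixed distance, with a countdown. -/

/-- An ant explores the cells at distance `h`, and is going to reach the northern ray again after
`n - 1` steps. -/
def Exploring (h n : ℕ) : SearchState → Cell → Prop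
  | zig d, c => coord d c + coord d.cw c = h ∧ 0 ≤ coord d c ∧ 1 ≤ coord d.cw c ∧
      (n : ℤ) = 2 * coord d c + 1 + 2 * h * quadrants d
  | zag d, c => coord d c + coord d.cw c = h + 1 ∧ 1 ≤ coord d c ∧ 1 ≤ coord d.cw c ∧
      (n : ℤ) = 2 * coord d c + 2 * h * quadrants d
  | _, _ => False
where
  /-- The number of quadrants that remain to be explored after the one that begins at `d`. -/
  quadrants : Dir → ℤ
    | north => 3
    | east => 2
    | south => 1
    | west => 0

/-- Inside a quadrant no pheromone is sensed. The path meets the next axis exactly at distance `h`,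
where `hρ` guarantees a pheromone, so the ant turns at the right cell. -/
theorem Exploring.step {h n : ℕ} {ρ : Dir → ℕ} (hρ : ∀ d, h ≤ ρ d) {q : SearchState} {c : Cell}
    (hq : Exploring h (n + 1) q c) {b : Bool} (hb : b = true ↔ OnRays ρ c) :
    (1 ≤ n ∧ Exploring h n (searchTrans q b).next (c + displacement (searchTrans q b).move)) ∨
    (n = 0 ∧ (searchTrans q b).next = back north ∧
      coord north (c + displacement (searchTrans q b).move) = h - 1) := by
  have h1 := hρ east
  have h2 := hρ south
  have h3 := hρ west
  have h4 := hρ north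
  rw [onRays_iff] at hb
  obtain ⟨x, y⟩ := c
  rcases q with d | d | d | d <;> cases d <;> cases b <;>
    simp [Exploring, Exploring.quadrants, searchTrans, displacement, vec, cw, opp, coord] at * <;>
    omega

theorem Exploring.pos {h n : ℕ} {q : SearchState} {c : Cell} (hq : Exploring h n q c) :
    1 ≤ n ∧ n ≤ 8 * h := by
  rcases q with d | d | d | d <;> cases d <;>
    simp [Exploring, Exploring.quadrants, cw, coord] at * <;> omega

/-- The parity of the countdown separates zigs from zags and its size fixes the quadrant, so an ant
whose countdown matches that of the treasure stands on it. -/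
theorem Exploring.unique {h n : ℕ} {q q' : SearchState} {c c' : Cell} (hq : Exploring h n q c)
    (hq' : Exploring h n q' c') : c = c' := by
  obtain ⟨x, y⟩ := c
  obtain ⟨x', y'⟩ := c'
  rcases q with d | d | d | d <;> cases d <;> rcases q' with d | d | d | d <;> cases d <;>
    simp [Exploring, Exploring.quadrants, cw, coord] at * <;> omega

theorem exists_exploring {x : Cell} (hx : 1 ≤ distNest x) :
    ∃ n q, Exploring (distNest x) n q x := by
  obtain ⟨x, y⟩ := x
  simp only [distNest] at *
  set h := x.natAbs + y.natAbs with hh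
  by_cases h1 : 1 ≤ x ∧ 0 ≤ y
  · refine ⟨(2 * y + 1 + 6 * h).toNat, zig north, ?_⟩
    simp [Exploring, Exploring.quadrants, cw, coord]; omega
  by_cases h2 : y ≤ -1 ∧ 0 ≤ x
  · refine ⟨(2 * x + 1 + 4 * h).toNat, zig east, ?_⟩
    simp [Exploring, Exploring.quadrants, cw, coord]; omega
  by_cases h3 : x ≤ -1 ∧ y ≤ 0
  · refine ⟨(2 * -y + 1 + 2 * h).toNat, zig south, ?_⟩
    simp [Exploring, Exploring.quadrants, cw, coord]; omega
  · refine ⟨(2 * -x + 1).toNat, zig west, ?_⟩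
    simp [Exploring, Exploring.quadrants, cw, coord]; omega

/-! ### Rounds -/

section Rounds

variable {k : ℕ} {σ : ℕ → Fin k}

theorem exists_step_in_round (hσ : Fair σ) (r : ℕ) (a : Fin k) :
    ∃ s, roundEnd σ r ≤ s ∧ s < roundEnd σ (r + 1) ∧ σ s = a := by
  have hne : {t | ∀ a, ∃ s, roundEnd σ r ≤ s ∧ s < t ∧ σ s = a}.Nonempty := by
    choose f hf using fun a => hσ a (roundEnd σ r)
    refine ⟨Finset.univ.sup f + 1, fun a => ⟨f a, (hf a).1, ?_, (hf a).2⟩⟩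
    exact Nat.lt_succ_of_le (Finset.le_sup (Finset.mem_univ a))
  exact Nat.sInf_mem hne a

/-- A quantity that never grows, and decreases with every step of the ant `a`, vanishes after as
many rounds. -/
theorem progress (hσ : Fair σ) (a : Fin k) {P : ℕ → ℕ → Prop}
    (h1 : ∀ t n, P t n → P (t + 1) n)
    (h2 : ∀ t n, σ t = a → P t (n + 1) → P (t + 1) n) (n : ℕ) :
    ∀ {t r : ℕ}, t ≤ roundEnd σ r → P t n → P (roundEnd σ (r + n)) 0 := by
  have mono : ∀ n {t t' : ℕ}, t ≤ t' → P t n → P t' n := fun n t t' htt' h =>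
    Nat.le_induction h (fun s _ hs => h1 s n hs) t' htt'
  induction n with
  | zero => exact fun ht h => mono 0 ht h
  | succ n ih =>
    intro t r ht h
    obtain ⟨s, hs, hs', hsa⟩ := exists_step_in_round hσ r a
    have := h2 s n hsa (mono _ (ht.trans hs) h)
    have := ih (r := r + 1) hs' this
    rwa [show r + (n + 1) = r + 1 + n by ring]

end Rounds

/-! ### Executions -/

section Execution

variable {k : ℕ} (allow : Supply) (σ : ℕ → Fin k)

/-- The control state of the ant `a` after `t` steps. -/
def stateAt (t : ℕ) (a : Fin k) : SearchState := (run searchFSM allow σ t).state a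

/-- The cell of the ant `a` after `t` steps. -/
def posAt (t : ℕ) (a : Fin k) : Cell := (run searchFSM allow σ t).pos a

/-- The cells that hold a pheromone after `t` steps. -/
def pherAt (t : ℕ) : Finset Cell := (run searchFSM allow σ t).pheromones

/-- The number of pheromones emitted in the first `t` steps. -/
def emittedAt (t : ℕ) : ℕ := (run searchFSM allow σ t).emitted

/-- The ant that makes step `t` senses a pheromone. -/
def senses (t : ℕ) : Bool := decide (posAt allow σ t (σ t) ∈ pherAt allow σ t)

/-- The action taken in step `t`. -/
def actAt (t : ℕ) : Action SearchState := searchTrans (stateAt allow σ t (σ t)) (senses allow σ t)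

/-- In step `t`, it is attempted to extend the ray in direction `d`. -/
def Attempts (t : ℕ) (d : Dir) : Prop :=
  stateAt allow σ t (σ t) = out d ∧ senses allow σ t = false

open Classical in
/-- The number of attempts of the ant `a` to extend the ray `d` in the first `t` steps. -/
noncomputable def attempts : ℕ → Fin k → Dir → ℕ
  | 0, _, _ => 0
  | t + 1, a, d => attempts t a d + if σ t = a ∧ Attempts allow σ t d then 1 else 0

open Classical in
/-- The length of the ray `d` after `t` steps. -/
noncomputable def ray : ℕ → Dir → ℕ
  | 0, _ => 0
  | t + 1, d => ray t d + if Attempts allow σ t d ∧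
      allow (posAt allow σ t (σ t)) (emittedAt allow σ t) = true then 1 else 0

/-- The number of attempts to extend the ray `d` in the first `t` steps. -/
noncomputable def total (t : ℕ) (d : Dir) : ℕ := ∑ a, attempts allow σ t a d

variable {allow σ}

theorem stateAt_succ_self (t : ℕ) :
    stateAt allow σ (t + 1) (σ t) = (actAt allow σ t).next := by
  simp only [stateAt, run, Config.step, Function.update_self]; rfl

theorem posAt_succ_self (t : ℕ) : posAt allow σ (t + 1) (σ t) =
    posAt allow σ t (σ t) + displacement (actAt allow σ t).move := by
  simp only [posAt, run, Config.step, Function.update_self]; rfl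

theorem stateAt_succ_of_ne {t : ℕ} {a : Fin k} (h : a ≠ σ t) :
    stateAt allow σ (t + 1) a = stateAt allow σ t a := by
  simp only [stateAt, run, Config.step, Function.update_of_ne h]; rfl

theorem posAt_succ_of_ne {t : ℕ} {a : Fin k} (h : a ≠ σ t) :
    posAt allow σ (t + 1) a = posAt allow σ t a := by
  simp only [posAt, run, Config.step, Function.update_of_ne h]

theorem pherAt_succ (t : ℕ) : pherAt allow σ (t + 1) =
    if (actAt allow σ t).emit && allow (posAt allow σ t (σ t)) (emittedAt allow σ t) then
      insert (posAt allow σ t (σ t)) (pherAt allow σ t) else pherAt allow σ t := rfl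

theorem emittedAt_succ (t : ℕ) : emittedAt allow σ (t + 1) =
    if (actAt allow σ t).emit && allow (posAt allow σ t (σ t)) (emittedAt allow σ t) then
      emittedAt allow σ t + 1 else emittedAt allow σ t := rfl

theorem emit_iff (t : ℕ) : (actAt allow σ t).emit = true ↔ ∃ d, Attempts allow σ t d := by
  unfold actAt Attempts
  generalize stateAt allow σ t (σ t) = q
  generalize senses allow σ t = b
  rcases q with d | d | d | d <;> cases d <;> cases b <;> simp [searchTrans]

theorem ray_succ_of_attempts {t : ℕ} {d : Dir} (h : Attempts allow σ t d)
    (h' : allow (posAt allow σ t (σ t)) (emittedAt allow σ t) = true) :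
    ray allow σ (t + 1) d = ray allow σ t d + 1 := by
  simp [ray, h, h']

theorem ray_succ_of_not {t : ℕ} {d : Dir} (h : ¬ (Attempts allow σ t d ∧
      allow (posAt allow σ t (σ t)) (emittedAt allow σ t) = true)) :
    ray allow σ (t + 1) d = ray allow σ t d := by
  simp [ray, h]

theorem ray_le_succ (t : ℕ) (d : Dir) : ray allow σ t d ≤ ray allow σ (t + 1) d := by
  simp [ray]

theorem Attempts.eq {t : ℕ} {d d' : Dir} (h : Attempts allow σ t d) (h' : Attempts allow σ t d') :
    d' = d := by
  simpa using h'.1.symm.trans h.1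

theorem total_succ_of_attempts {t : ℕ} {d : Dir} (h : Attempts allow σ t d) :
    total allow σ (t + 1) d = total allow σ t d + 1 := by
  simp [total, attempts, h, Finset.sum_add_distrib]

theorem total_succ_of_not {t : ℕ} {d : Dir} (h : ¬ Attempts allow σ t d) :
    total allow σ (t + 1) d = total allow σ t d := by
  simp [total, attempts, h]

theorem total_le_succ (t : ℕ) (d : Dir) : total allow σ t d ≤ total allow σ (t + 1) d := by
  by_cases h : Attempts allow σ t d
  · rw [total_succ_of_attempts h]; omega
  · rw [total_succ_of_not h]

theorem ray_le_total (t : ℕ) (d : Dir) : ray allow σ t d ≤ total allow σ t d := by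
  induction t with
  | zero => simp [ray]
  | succ t ih =>
    by_cases h : Attempts allow σ t d
    · rw [total_succ_of_attempts h, ray]; split_ifs <;> omega
    · rw [total_succ_of_not h, ray_succ_of_not (fun h' => h h'.1)]; exact ih

/-- Each successful emission lengthens exactly one ray, so bounds on rays are bounds on the supply
used. -/
theorem emittedAt_eq (t : ℕ) : emittedAt allow σ t =
    ray allow σ t east + ray allow σ t south + ray allow σ t west + ray allow σ t north := by
  induction t with
  | zero => rfl
  | succ t ih =>
    rw [emittedAt_succ]
    by_cases h : (actAt allow σ t).emit = true ∧
        allow (posAt allow σ t (σ t)) (emittedAt allow σ t) = true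
    · obtain ⟨d, hd⟩ := (emit_iff t).1 h.1
      have key : ∀ d' ≠ d, ray allow σ (t + 1) d' = ray allow σ t d' :=
        fun d' hd' => ray_succ_of_not fun h' => hd' (hd.eq h'.1)
      have := ray_succ_of_attempts hd h.2
      rw [if_pos (by simp [h]), ih]
      cases d <;> simp [this, key] <;> omega
    · have key : ∀ d', ray allow σ (t + 1) d' = ray allow σ t d' :=
        fun d' => ray_succ_of_not fun h' => h ⟨(emit_iff t).2 ⟨d', h'.1⟩, h'.2⟩
      rw [if_neg (by simpa using h), ih]
      simp [key]

/-- The two claims need a joint induction: positions show that an emission lands at the tip of a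
ray, and the shape of the pheromones governs the next positions. -/
theorem antInv_and_mem_pherAt (t : ℕ) :
    (∀ c, c ∈ pherAt allow σ t ↔ OnRays (ray allow σ t) c) ∧
      ∀ a, AntInv (ray allow σ t) (stateAt allow σ t a) (posAt allow σ t a) := by
  induction t with
  | zero =>
    refine ⟨fun c => ?_, fun a => ?_⟩
    · simp only [onRays_iff, pherAt, run, initial, ray]
      simp; omega
    · simp [stateAt, posAt, run, initial, searchFSM, AntInv, coord, cw]
  | succ t ih =>
    obtain ⟨hp, ha⟩ := ih
    have hs : senses allow σ t = true ↔ OnRays (ray allow σ t) (posAt allow σ t (σ t)) := by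
      rw [senses, decide_eq_true_iff, hp]
    refine ⟨fun c => ?_, fun a => ?_⟩
    · rw [pherAt_succ]
      by_cases h : (actAt allow σ t).emit = true ∧
        allow (posAt allow σ t (σ t)) (emittedAt allow σ t) = true
      · obtain ⟨d, hd⟩ := (emit_iff t).1 h.1
        have key : ∀ d' ≠ d, ray allow σ (t + 1) d' = ray allow σ t d' :=
          fun d' hd' => ray_succ_of_not fun h' => hd' (hd.eq h'.1)
        have h1 := ray_succ_of_attempts hd h.2
        have h2 := ha (σ t)
        rw [hd.1] at h2
        rw [hd.2, onRays_iff] at hs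
        rw [if_pos (by simp [h]), Finset.mem_insert, hp, onRays_iff, onRays_iff, Prod.ext_iff]
        cases d <;> simp [h1, key] <;> simp [AntInv, coord, cw] at h2 hs <;> omega
      · have key : ∀ d', ray allow σ (t + 1) d' = ray allow σ t d' :=
          fun d' => ray_succ_of_not fun h' => h ⟨(emit_iff t).2 ⟨d', h'.1⟩, h'.2⟩
        rw [if_neg (by simpa using h), hp, funext key]
    · by_cases h : a = σ t
      · subst h
        rw [stateAt_succ_self, posAt_succ_self]
        exact ((ha _).step hs).mono (ray_le_succ t)
      · rw [stateAt_succ_of_ne h, posAt_succ_of_ne h]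
        exact (ha a).mono (ray_le_succ t)

theorem antInv (t : ℕ) (a : Fin k) :
    AntInv (ray allow σ t) (stateAt allow σ t a) (posAt allow σ t a) :=
  (antInv_and_mem_pherAt t).2 a

theorem senses_iff (t : ℕ) :
    senses allow σ t = true ↔ OnRays (ray allow σ t) (posAt allow σ t (σ t)) := by
  rw [senses, decide_eq_true_iff, (antInv_and_mem_pherAt t).1]

open Classical in
theorem countInv (t : ℕ) (a : Fin k) : CountInv (attempts allow σ t a) (stateAt allow σ t a) := by
  induction t with
  | zero => simp [stateAt, run, initial, searchFSM, CountInv, attempts]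
  | succ t ih =>
    by_cases h : a = σ t
    · subst h
      rw [stateAt_succ_self]
      exact ih.step (senses allow σ t) fun d => by
        rw [attempts]; exact congrArg _ (if_congr (and_iff_right rfl) rfl rfl)
    · rw [stateAt_succ_of_ne h]
      rwa [show attempts allow σ (t + 1) a = attempts allow σ t a from
        funext fun d => by simp [attempts, Ne.symm h]]

theorem coord_of_attempts {t : ℕ} {d : Dir} (h : Attempts allow σ t d) :
    coord d.cw (posAt allow σ t (σ t)) = 0 ∧
      coord d (posAt allow σ t (σ t)) = ray allow σ t d + 1 := by
  have h1 := antInv (allow := allow) (σ := σ) t (σ t)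
  have h2 := senses_iff (allow := allow) (σ := σ) t
  rw [h.1] at h1
  rw [h.2, onRays_iff] at h2
  cases d <;> simp [AntInv, coord, cw] at * <;> omega

theorem distNest_of_attempts {t : ℕ} {d : Dir} (h : Attempts allow σ t d) :
    distNest (posAt allow σ t (σ t)) = ray allow σ t d + 1 := by
  have := coord_of_attempts h
  unfold distNest
  cases d <;> simp only [coord, cw] at * <;> omega

theorem total_le (t : ℕ) (d : Dir) : total allow σ t north ≤ total allow σ t d ∧
    total allow σ t d ≤ total allow σ t north + k := by
  have key : ∀ a, attempts allow σ t a north ≤ attempts allow σ t a d ∧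
      attempts allow σ t a d ≤ attempts allow σ t a north + 1 := by
    intro a
    have := countInv (allow := allow) (σ := σ) t a
    generalize stateAt allow σ t a = q at this
    rcases q with e | e | e | e <;> cases e <;> cases d <;> simp only [CountInv] at this <;> omega
  refine ⟨Finset.sum_le_sum fun a _ => (key a).1, ?_⟩
  calc total allow σ t d ≤ ∑ a, (attempts allow σ t a north + 1) :=
        Finset.sum_le_sum fun a _ => (key a).2
    _ = _ := by simp [total, Finset.sum_add_distrib]

end Execution

/-! ### Sufficient supply and correctness of explorations. -/

section Progress

variable {k : ℕ} {allow : Supply} {σ : ℕ → Fin k}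

theorem exploring_of_attempts_north {t : ℕ} (h : Attempts allow σ t north) :
    Exploring (ray allow σ t north + 1) (8 * (ray allow σ t north + 1))
      (stateAt allow σ (t + 1) (σ t)) (posAt allow σ (t + 1) (σ t)) := by
  have hc := coord_of_attempts h
  rw [stateAt_succ_self, posAt_succ_self, actAt, h.1, h.2]
  simp [searchTrans, displacement, vec, cw, coord, Exploring, Exploring.quadrants] at *
  omega

theorem exploring_origin {q : SearchState} {b : Bool} {d : Dir}
    (h : (searchTrans q b).next = zig d ∨ (searchTrans q b).next = zag d) :
    (q = out north ∧ b = false) ∨ ∃ e, q = zig e ∨ q = zag e := by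
  rcases q with e | e | e | e <;> cases e <;> cases b <;> simp [searchTrans] at h ⊢

theorem Exploring.at_succ {h n t : ℕ} {a : Fin k} (hρ : ∀ d, h ≤ ray allow σ t d) (ha : σ t = a)
    (hq : Exploring h (n + 1) (stateAt allow σ t a) (posAt allow σ t a)) :
    (1 ≤ n ∧ Exploring h n (stateAt allow σ (t + 1) a) (posAt allow σ (t + 1) a)) ∨
    (n = 0 ∧ stateAt allow σ (t + 1) a = back north ∧
      coord north (posAt allow σ (t + 1) a) = h - 1) := by
  subst ha
  rw [stateAt_succ_self, posAt_succ_self]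
  exact hq.step hρ (senses_iff t)

/-- While no more than `D` explorations have begun, failures of emissions at distance more than `D`
do not matter. -/
theorem ray_ge_and_exploring {D : ℕ}
    (hallow : ∀ c n, distNest c ≤ D → n ≤ 4 * D + 3 * k → allow c n = true) (t : ℕ)
    (ht : total allow σ t north ≤ D) :
    (∀ d, min D (total allow σ t d) ≤ ray allow σ t d) ∧
    ∀ a d, stateAt allow σ t a = zig d ∨ stateAt allow σ t a = zag d →
      ∃ h n, h ≤ D ∧ (∀ d', h ≤ ray allow σ t d') ∧
        Exploring h n (stateAt allow σ t a) (posAt allow σ t a) := by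
  induction t with
  | zero =>
    refine ⟨fun d => by simp [total, attempts], fun a d h => ?_⟩
    simp [stateAt, run, initial, searchFSM] at h
  | succ t ih =>
    obtain ⟨h1, h2⟩ := ih ((total_le_succ t north).trans ht)
    have hray : ∀ d, min D (total allow σ (t + 1) d) ≤ ray allow σ (t + 1) d := by
      intro d
      by_cases hd : Attempts allow σ t d
      · have hd1 := h1 d
        by_cases hD : D ≤ ray allow σ t d
        · exact (min_le_left _ _).trans (hD.trans (ray_le_succ t d))
        · rw [ray_succ_of_attempts hd, total_succ_of_attempts hd]
          · omega
          · apply hallow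
            · rw [distNest_of_attempts hd]; omega
            -- The rays sum to at most the four totals, each at most `total north + k`; this is the
            -- origin of `4D + 3k`.
            · rw [emittedAt_eq]
              have hr := ray_le_total (allow := allow) (σ := σ) t
              have hl := total_le (allow := allow) (σ := σ) t
              have := total_le_succ (allow := allow) (σ := σ) t north
              have := hr east; have := hr south; have := hr west; have := hr north
              have := hl east; have := hl south; have := hl west
              omega
      · rw [total_succ_of_not hd]
        exact (h1 d).trans (ray_le_succ t d)
    refine ⟨hray, fun a d had => ?_⟩
    by_cases ha : a = σ t
    swap
    · rw [stateAt_succ_of_ne ha] at had ⊢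
      rw [posAt_succ_of_ne ha]
      obtain ⟨h, n, hD, hρ, hE⟩ := h2 a d had
      exact ⟨h, n, hD, fun d' => (hρ d').trans (ray_le_succ t d'), hE⟩
    by_cases hN : Attempts allow σ t north
    · subst ha
      have h3 := ray_le_total (allow := allow) (σ := σ) t north
      have h4 := total_succ_of_attempts hN
      -- The new distance is at most the northern total after this step, which is at most `D` and at
      -- most every other total.
      refine ⟨_, _, by omega, fun d' => ?_, exploring_of_attempts_north hN⟩
      have := (total_le (allow := allow) (σ := σ) (t + 1) d').1
      have := hray d'
      omega
    · have hz : ∃ e, stateAt allow σ t a = zig e ∨ stateAt allow σ t a = zag e := by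
        subst ha
        rw [stateAt_succ_self] at had
        exact (exploring_origin had).resolve_left hN
      obtain ⟨e, he⟩ := hz
      obtain ⟨h, n, hD, hρ, hE⟩ := h2 a e he
      obtain ⟨n, rfl⟩ : ∃ m, n = m + 1 := ⟨n - 1, by have := hE.pos; omega⟩
      rcases hE.at_succ hρ ha.symm with h' | h'
      · exact ⟨h, n, hD, fun d' => (hρ d').trans (ray_le_succ t d'), h'.2⟩
      · rw [h'.2.1] at had; simp at had

/-! ### Time until the next attempt of each ant. -/

/-- The number of attempts of the ant `a` on the ray after `d` that follow those on the ray `d`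
made in the first `t` steps. -/
noncomputable def target (allow : Supply) (σ : ℕ → Fin k) (t : ℕ) (a : Fin k) : Dir → ℕ
  | north => attempts allow σ t a north + 1
  | d => attempts allow σ t a d

theorem attempts_mono (a : Fin k) (d : Dir) : Monotone fun t => attempts allow σ t a d :=
  monotone_nat_of_le_succ fun t => by simp [attempts]

/-- The ant `a` needs at most `n` further steps for its next attempt on the ray after `d`, if this
ray is shorter than `D`. -/
def Approaching (allow : Supply) (σ : ℕ → Fin k) (D : ℕ) (a : Fin k) (d : Dir) (t n : ℕ) : Prop :=
  (stateAt allow σ t a = out d.cw ∧ (D : ℤ) + 1 ≤ n + coord d.cw (posAt allow σ t a)) ∨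
  (stateAt allow σ t a = back d ∧ coord d (posAt allow σ t a) + D + 1 ≤ n) ∨
  (d = north ∧ ∃ h m, h ≤ D ∧ (∀ d', h ≤ ray allow σ t d') ∧
    Exploring h m (stateAt allow σ t a) (posAt allow σ t a) ∧ m + 2 * D ≤ n)

theorem Approaching.of_ne {D : ℕ} {a : Fin k} {d : Dir} {t n : ℕ} (ha : σ t ≠ a)
    (h : Approaching allow σ D a d t n) : Approaching allow σ D a d (t + 1) n := by
  unfold Approaching at *
  rw [stateAt_succ_of_ne ha.symm, posAt_succ_of_ne ha.symm]
  refine h.imp_right (Or.imp_right (And.imp_right ?_))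
  rintro ⟨h, m, hD, hρ, h'⟩
  exact ⟨h, m, hD, fun d' => (hρ d').trans (ray_le_succ t d'), h'⟩

theorem Approaching.mono {D : ℕ} {a : Fin k} {d : Dir} {t n n' : ℕ} (hn : n ≤ n')
    (h : Approaching allow σ D a d t n) : Approaching allow σ D a d t n' := by
  rcases h with h | h | ⟨hd, h, m, hD, hρ, hE, hm⟩
  · exact Or.inl ⟨h.1, by omega⟩
  · exact Or.inr (Or.inl ⟨h.1, by omega⟩)
  · exact Or.inr (Or.inr ⟨hd, h, m, hD, hρ, hE, by omega⟩)

theorem Approaching.step {D : ℕ} {a : Fin k} {d : Dir} {t n : ℕ} (ha : σ t = a)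
    (h : Approaching allow σ D a d t (n + 1)) :
    Attempts allow σ t d.cw ∨ Approaching allow σ D a d (t + 1) n := by
  subst ha
  rcases h with h | h | ⟨rfl, h, m, hD, hρ, hE, hm⟩
  · rcases hs : senses allow σ t with _ | _
    · exact Or.inl ⟨h.1, hs⟩
    · right; left
      rw [stateAt_succ_self, posAt_succ_self, actAt, h.1, hs]
      refine ⟨by cases d <;> rfl, ?_⟩
      have := h.2
      cases d <;> simp [searchTrans, displacement, vec, cw, coord] at * <;> omega
  · right
    have h1 := antInv (allow := allow) (σ := σ) t (σ t)
    have h2 := senses_iff (allow := allow) (σ := σ) t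
    rw [h.1] at h1
    rw [onRays_iff] at h2
    have h3 := h.2
    unfold Approaching
    rw [stateAt_succ_self, posAt_succ_self, actAt, h.1]
    rcases hs : senses allow σ t with _ | _
    · left
      rw [hs] at h2
      cases d <;> simp [AntInv, searchTrans, displacement, vec, cw, coord] at * <;> omega
    · right; left
      rw [hs] at h2
      cases d <;> simp [AntInv, searchTrans, displacement, vec, cw, opp, coord] at * <;> omega
  · obtain ⟨m, rfl⟩ : ∃ l, m = l + 1 := ⟨m - 1, by have := hE.pos; omega⟩
    right; right
    rcases hE.at_succ hρ rfl with h' | h'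
    · exact Or.inr ⟨rfl, h, m, hD, fun d' => (hρ d').trans (ray_le_succ t d'), h'.2, by omega⟩
    · exact Or.inl ⟨h'.2.1, by omega⟩

/-- By the cyclic order, an ant in any other state has already made its attempt. The worst case is
an exploration (`8D` steps) followed by the way back and out (`2D`); the extra 1 covers the step at
the nest when `D = 0`. -/
theorem target_le_or_approaching {D : ℕ} {a : Fin k} {d : Dir} {t : ℕ} (hd : ray allow σ t d ≤ D)
    (hexp : d = north → ∀ e, stateAt allow σ t a = zig e ∨ stateAt allow σ t a = zag e →
      ∃ h n, h ≤ D ∧ (∀ d', h ≤ ray allow σ t d') ∧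
        Exploring h n (stateAt allow σ t a) (posAt allow σ t a)) :
    target allow σ t a d ≤ attempts allow σ t a d.cw ∨
      Approaching allow σ D a d t (10 * D + 1) := by
  by_cases h1 : stateAt allow σ t a = out d.cw
  · refine Or.inr (Or.inl ⟨h1, ?_⟩)
    have := antInv (allow := allow) (σ := σ) t a
    rw [h1] at this
    have := this.2.1
    omega
  by_cases h2 : stateAt allow σ t a = back d
  · refine Or.inr (Or.inr (Or.inl ⟨h2, ?_⟩))
    have := antInv (allow := allow) (σ := σ) t a
    rw [h2] at this
    have := this.2.2
    omega
  by_cases h3 : d = north ∧ ∃ e, stateAt allow σ t a = zig e ∨ stateAt allow σ t a = zag e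
  · obtain ⟨hn, e, he⟩ := h3
    obtain ⟨h, n, hD, hρ, hE⟩ := hexp hn e he
    exact Or.inr (Or.inr (Or.inr ⟨hn, h, n, hD, hρ, hE, by have := hE.pos; omega⟩))
  left
  have := countInv (allow := allow) (σ := σ) t a
  generalize stateAt allow σ t a = q at *
  rcases q with e | e | e | e <;> cases e <;> cases d <;> simp [CountInv, cw, target] at * <;> omega

theorem target_le (t : ℕ) (a : Fin k) (d : Dir) :
    target allow σ t a d ≤ attempts allow σ t a d.cw + 1 := by
  have := countInv (allow := allow) (σ := σ) t a
  generalize stateAt allow σ t a = q at *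
  rcases q with e | e | e | e <;> cases e <;> cases d <;> simp [CountInv, cw, target] at * <;> omega

/-- With no steps left, the only possible state is outward at distance beyond `D`, and an outward
ant is at most one cell past the tip. -/
theorem Approaching.le_ray {D : ℕ} {a : Fin k} {d : Dir} {t : ℕ}
    (h : Approaching allow σ D a d t 0) : D ≤ ray allow σ t d.cw := by
  have h1 := antInv (allow := allow) (σ := σ) t a
  rcases h with h | h | ⟨-, h, m, -, -, hE, hm⟩
  · rw [h.1] at h1
    have := h1.2.2
    have := h.2
    omega
  · rw [h.1] at h1
    have := h1.2.1
    have := h.2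
    omega
  · have := hE.pos
    omega

/-- Other ants may lengthen the ray ahead of `a` and delay it, but only past `D` can this exhaust
the countdown, and then the total is large enough anyway. Otherwise every ant meets its target, and
the targets sum to at least `m`. -/
theorem le_total_cw {D : ℕ} (hσ : Fair σ) {d : Dir} {t r m : ℕ} (hr : t ≤ roundEnd σ r)
    (hd : ray allow σ t d ≤ D)
    (hexp : d = north → ∀ a e, stateAt allow σ t a = zig e ∨ stateAt allow σ t a = zag e →
      ∃ h n, h ≤ D ∧ (∀ d', h ≤ ray allow σ t d') ∧
        Exploring h n (stateAt allow σ t a) (posAt allow σ t a))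
    (hm : m ≤ ∑ a, target allow σ t a d) (hmD : m ≤ D) :
    m ≤ total allow σ (roundEnd σ (r + (10 * D + 1))) d.cw := by
  by_contra! hlt
  refine absurd (hm.trans (Finset.sum_le_sum fun a _ => ?_)) (not_le.2 hlt)
  have hfin : ∀ s, Approaching allow σ D a d s 0 → m ≤ total allow σ s d.cw := fun s h =>
    hmD.trans (h.le_ray.trans (ray_le_total s d.cw))
  have key := progress hσ a (P := fun s n => t ≤ s ∧ (m ≤ total allow σ s d.cw ∨
      target allow σ t a d ≤ attempts allow σ s a d.cw ∨ Approaching allow σ D a d s n))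
      ?_ ?_ (10 * D + 1) hr
      ⟨le_rfl, Or.inr (target_le_or_approaching hd fun h => hexp h a)⟩
  · rcases key.2 with h | h | h
    · omega
    · exact h
    · have := hfin _ h
      omega
  all_goals
    have hstep : ∀ s n, σ s = a → t ≤ s → Approaching allow σ D a d s (n + 1) →
        target allow σ t a d ≤ attempts allow σ (s + 1) a d.cw ∨
          Approaching allow σ D a d (s + 1) n := by
      intro s n hs hts h
      refine (h.step hs).imp_left fun hA => ?_
      calc target allow σ t a d ≤ attempts allow σ t a d.cw + 1 := target_le t a d
        _ ≤ attempts allow σ s a d.cw + 1 := Nat.succ_le_succ (attempts_mono a d.cw hts)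
        _ = attempts allow σ (s + 1) a d.cw := by simp [attempts, hs, hA]
  · rintro s n ⟨hts, h | h | h⟩
    · exact ⟨by omega, Or.inl (h.trans (total_le_succ s _))⟩
    · exact ⟨by omega, Or.inr (Or.inl (h.trans (attempts_mono a d.cw (Nat.le_succ s))))⟩
    · refine ⟨by omega, ?_⟩
      by_cases hs : σ s = a
      · rcases n with _ | n
        · exact Or.inl ((hfin s h).trans (total_le_succ s _))
        · exact Or.inr ((hstep s n hs hts h).imp_right (Approaching.mono (Nat.le_succ n)))
      · exact Or.inr (Or.inr (h.of_ne hs))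
  · rintro s n hs ⟨hts, h | h | h⟩
    · exact ⟨by omega, Or.inl (h.trans (total_le_succ s _))⟩
    · exact ⟨by omega, Or.inr (Or.inl (h.trans (attempts_mono a d.cw (Nat.le_succ s))))⟩
    · exact ⟨by omega, Or.inr (hstep s n hs hts h)⟩

theorem exists_first_total {d : Dir} {m t : ℕ} (h : m ≤ total allow σ t d) :
    ∃ s ≤ t, total allow σ s d = m := by
  induction t with
  | zero =>
    refine ⟨0, le_rfl, ?_⟩
    simp only [total, attempts, Finset.sum_const_zero] at *
    omega
  | succ t ih =>
    by_cases h' : m ≤ total allow σ t d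
    · obtain ⟨s, hs, hm⟩ := ih h'
      exact ⟨s, by omega, hm⟩
    · refine ⟨t + 1, le_rfl, ?_⟩
      by_cases hA : Attempts allow σ t d
      · rw [total_succ_of_attempts hA] at *; omega
      · rw [total_succ_of_not hA] at *; omega

theorem le_total_cw_of_ne_north {D : ℕ} (hσ : Fair σ) {d : Dir} (hdn : d ≠ north) {r m : ℕ}
    (hm : m ≤ D) (h : m ≤ total allow σ (roundEnd σ r) d) :
    m ≤ total allow σ (roundEnd σ (r + (10 * D + 1))) d.cw := by
  obtain ⟨t, ht, rfl⟩ := exists_first_total h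
  refine le_total_cw hσ ht ((ray_le_total t d).trans hm) (fun h => absurd h hdn) ?_ hm
  refine Finset.sum_le_sum fun a _ => ?_
  cases d <;> simp [target] at *

theorem min_add_le_total_north {D : ℕ} (hσ : Fair σ)
    (hallow : ∀ c n, distNest c ≤ D → n ≤ 4 * D + 3 * k → allow c n = true) {r m : ℕ}
    (hm : m ≤ D) (h : m ≤ total allow σ (roundEnd σ r) north) :
    min D (m + k) ≤ total allow σ (roundEnd σ (r + 4 * (10 * D + 1))) north := by
  -- At the end of the round the total may exceed `D`; going back to a time when it equals `m` keeps
  -- the rays and explorations under control.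
  obtain ⟨t, ht, rfl⟩ := exists_first_total h
  have h1 : min D (total allow σ t north + k) ≤ total allow σ _ east :=
    le_total_cw (d := north) hσ ht ((ray_le_total t north).trans hm)
      (fun _ => (ray_ge_and_exploring hallow t hm).2)
      (by simp [target, total, Finset.sum_add_distrib]) (min_le_left _ _)
  have h2 := le_total_cw_of_ne_north hσ (by simp) (min_le_left _ _) h1
  have h3 := le_total_cw_of_ne_north hσ (by simp [cw]) (min_le_left _ _) h2
  have h4 := le_total_cw_of_ne_north hσ (by simp [cw]) (min_le_left _ _) h3
  rw [show r + 4 * (10 * D + 1) =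
    r + (10 * D + 1) + (10 * D + 1) + (10 * D + 1) + (10 * D + 1) by ring]
  exact h4

theorem min_mul_le_total_north {D : ℕ} (hσ : Fair σ)
    (hallow : ∀ c n, distNest c ≤ D → n ≤ 4 * D + 3 * k → allow c n = true) (q : ℕ) :
    min D (q * k) ≤ total allow σ (roundEnd σ (q * (4 * (10 * D + 1)))) north := by
  induction q with
  | zero => simp
  | succ q ih =>
    have := min_add_le_total_north hσ hallow (min_le_left _ _) ih
    rw [show (q + 1) * (4 * (10 * D + 1)) = q * (4 * (10 * D + 1)) + 4 * (10 * D + 1) by ring]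
    refine le_trans ?_ this
    rw [show (q + 1) * k = q * k + k by ring]
    omega

theorem exists_exploring_of_le_total_north {D : ℕ} (hD : 1 ≤ D)
    (hallow : ∀ c n, distNest c ≤ D → n ≤ 4 * D + 3 * k → allow c n = true) {t : ℕ}
    (h : D ≤ total allow σ t north) :
    ∃ s ≤ t, (∀ d, D ≤ ray allow σ s d) ∧
      ∃ a, Exploring D (8 * D) (stateAt allow σ s a) (posAt allow σ s a) := by
  induction t with
  | zero => simp [total, attempts] at h; omega
  | succ t ih =>
    by_cases h' : D ≤ total allow σ t north
    · obtain ⟨s, hs, hE⟩ := ih h'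
      exact ⟨s, by omega, hE⟩
    have hA : Attempts allow σ t north := by
      by_contra hA
      rw [total_succ_of_not hA] at h
      exact h' h
    have h1 := total_succ_of_attempts hA
    have h2 := (ray_ge_and_exploring (σ := σ) hallow t (by omega)).1 north
    have h3 := ray_le_total (allow := allow) (σ := σ) t north
    have h4 := exploring_of_attempts_north hA
    -- The northern total was `D - 1`, and below `D` the ray is as long as its total.
    rw [show ray allow σ t north + 1 = D by omega] at h4
    refine ⟨t + 1, le_rfl, fun d => ?_, σ t, h4⟩
    have h5 := (ray_ge_and_exploring (σ := σ) hallow (t + 1) (by omega)).1 d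
    have h6 := (total_le (allow := allow) (σ := σ) (t + 1) d).1
    omega

theorem exists_posAt_eq {D : ℕ} (hD : 1 ≤ D) (hσ : Fair σ) {x : Cell} (hx : distNest x = D)
    {t r : ℕ} (hr : t ≤ roundEnd σ r) (hρ : ∀ d, D ≤ ray allow σ t d) {a : Fin k}
    (ha : Exploring D (8 * D) (stateAt allow σ t a) (posAt allow σ t a)) :
    ∃ s ≤ roundEnd σ (r + 8 * D), posAt allow σ s a = x := by
  subst hx
  obtain ⟨m, q, hm⟩ := exists_exploring hD
  have hm' := hm.pos
  have key := progress hσ a (P := fun s n => (∃ s' ≤ s, posAt allow σ s' a = x) ∨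
      ((∀ d, distNest x ≤ ray allow σ s d) ∧ ∃ e ≤ n,
        Exploring (distNest x) (m + e) (stateAt allow σ s a) (posAt allow σ s a)))
      ?_ ?_ (8 * distNest x) hr
      -- The countdown starts at `8D` and equals `m` at the treasure.
      (Or.inr ⟨hρ, 8 * distNest x - m, by omega, by rwa [Nat.add_sub_cancel' hm'.2]⟩)
  · rcases key with h | ⟨-, e, he, h⟩
    · exact h
    · obtain rfl : e = 0 := by omega
      exact ⟨_, le_rfl, h.unique hm⟩
  all_goals
    have hstep : ∀ s n, σ s = a → (∀ d, distNest x ≤ ray allow σ s d) → (∃ e ≤ n + 1,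
        Exploring (distNest x) (m + e) (stateAt allow σ s a) (posAt allow σ s a)) →
        (∃ s' ≤ s + 1, posAt allow σ s' a = x) ∨
        ((∀ d, distNest x ≤ ray allow σ (s + 1) d) ∧ ∃ e ≤ n, Exploring (distNest x) (m + e)
          (stateAt allow σ (s + 1) a) (posAt allow σ (s + 1) a)) := by
      rintro s n hs hρ ⟨e, he, hE⟩
      rcases e with _ | e
      · exact Or.inl ⟨s, by omega, hE.unique hm⟩
      · rcases Exploring.at_succ (n := m + e) hρ hs hE with h | h
        · exact Or.inr ⟨fun d => (hρ d).trans (ray_le_succ s d), e, by omega, h.2⟩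
        · omega
  · rintro s n (⟨s', hs', h⟩ | ⟨hρ, h⟩)
    · exact Or.inl ⟨s', by omega, h⟩
    · by_cases hs : σ s = a
      · obtain ⟨e, he, hE⟩ := h
        exact (hstep s n hs hρ ⟨e, by omega, hE⟩)
      · rw [stateAt_succ_of_ne (Ne.symm hs), posAt_succ_of_ne (Ne.symm hs)]
        exact Or.inr ⟨fun d => (hρ d).trans (ray_le_succ s d), h⟩
  · rintro s n hs (⟨s', hs', h⟩ | ⟨hρ, h⟩)
    · exact Or.inl ⟨s', by omega, h⟩
    · exact hstep s n hs hρ h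

theorem findsWithin_of_allow {D : ℕ} (hk : 0 < k) (hσ : Fair σ)
    (hallow : ∀ c n, distNest c ≤ D → n ≤ 4 * D + 3 * k → allow c n = true) {x : Cell}
    (hx : distNest x = D) :
    FindsWithin searchFSM allow σ x ((52 : ℕ) * (D + (D : ℝ) ^ 2 / k)) := by
  rcases Nat.eq_zero_or_pos D with rfl | hD
  · refine ⟨0, by simp, 0, Nat.zero_le _, ⟨0, hk⟩, ?_⟩
    simp only [distNest] at hx
    simp only [run, initial]
    exact Prod.ext (by simp; omega) (by simp; omega)
  have h1 := min_mul_le_total_north hσ hallow (D / k + 1)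
  have h2 : D ≤ (D / k + 1) * k := by
    have := Nat.lt_div_mul_add (a := D) hk
    rw [add_mul, one_mul]; omega
  rw [min_eq_left h2] at h1
  obtain ⟨t, ht, hρ, a, ha⟩ := exists_exploring_of_le_total_north hD hallow h1
  obtain ⟨s, hs, hsx⟩ := exists_posAt_eq hD hσ hx ht hρ ha
  refine ⟨_, ?_, s, hs, a, hsx⟩
  have h3 : ((D / k : ℕ) : ℝ) ≤ D / k := Nat.cast_div_le
  have h4 : (1 : ℝ) ≤ D := by exact_mod_cast hD
  push_cast
  calc ((D / k : ℕ) + 1 : ℝ) * (4 * (10 * D + 1)) + 8 * D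
      ≤ ((D : ℝ) / k + 1) * (44 * D) + 8 * D := by
        -- Uses `1 ≤ D`. Together with the final `8D` this gives `52 = 44 + 8`.
        have h5 : 4 * (10 * D + 1) ≤ 44 * (D : ℝ) := by linarith
        gcongr
    _ = 44 * ((D : ℝ) ^ 2 / k) + 52 * D := by ring
    _ ≤ 52 * (D + (D : ℝ) ^ 2 / k) := by
      have : 0 ≤ (D : ℝ) ^ 2 / k := by positivity
      linarith

theorem ray_le_of_allow {D : ℕ} (h : ∀ c n, allow c n = true → distNest c ≤ D) (t : ℕ) (d : Dir) :
    ray allow σ t d ≤ D := by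
  induction t with
  | zero => simp [ray]
  | succ t ih =>
    by_cases hA : Attempts allow σ t d ∧
        allow (posAt allow σ t (σ t)) (emittedAt allow σ t) = true
    · rw [ray_succ_of_attempts hA.1 hA.2, ← distNest_of_attempts hA.1]
      exact h _ _ hA.2
    · rw [ray_succ_of_not hA]
      exact ih

end Progress

/-! ### The admissible cells for the third claim, and the conclusion. -/

/-- The cells at distance at most `D` from the nest. -/
noncomputable def ball (D : ℕ) : Finset Cell :=
  (Finset.Icc (-D : ℤ) D ×ˢ Finset.Icc (-D : ℤ) D).filter fun c => distNest c ≤ D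

theorem mem_ball {D : ℕ} {c : Cell} : c ∈ ball D ↔ distNest c ≤ D := by
  rw [ball, Finset.mem_filter, Finset.mem_product, Finset.mem_Icc, Finset.mem_Icc]
  simp only [distNest]
  omega

end AntSearch

open AntSearch
theorem mainTheorem3 :
    ∃ C : ℕ,
      (∀ (k : ℕ) (_ : 0 < k) (D : ℕ) (x : Cell) (_ : distNest x = D)
        (σ : ℕ → Fin k) (_ : Fair σ),
        FindsWithin searchFSM Supply.unlimited σ x (C * (D + (D : ℝ) ^ 2 / k))) ∧
      (∀ (k : ℕ) (_ : 0 < k) (D : ℕ) (x : Cell) (_ : distNest x = D)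
        (σ : ℕ → Fin k) (_ : Fair σ) (B : ℕ) (_ : C * max D k ≤ B),
        FindsWithin searchFSM (Supply.budget B) σ x (C * (D + (D : ℝ) ^ 2 / k))) ∧
      (∀ D : ℕ, ∃ S : Finset Cell,
        ∀ (k : ℕ) (_ : 0 < k) (x : Cell) (_ : distNest x = D)
          (σ : ℕ → Fin k) (_ : Fair σ),
          (∀ t, (run searchFSM (Supply.onCells S) σ t).emitted ≤ C * D) ∧
          FindsWithin searchFSM (Supply.onCells S) σ x (C * (D + (D : ℝ) ^ 2 / k))) := by
  refine ⟨52, fun k hk D x hx σ hσ => ?_, fun k hk D x hx σ hσ B hB => ?_,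
    fun D => ⟨ball D, fun k hk x hx σ hσ => ⟨fun t => ?_, ?_⟩⟩⟩
  · exact findsWithin_of_allow hk hσ (fun _ _ _ _ => rfl) hx
  · refine findsWithin_of_allow hk hσ (fun c n _ hn => ?_) hx
    simp only [Supply.budget, decide_eq_true_iff]
    -- Strict inequality `4D + 3k < 52 max(D, k)` holds because `k` is positive.
    omega
  · have h := ray_le_of_allow (allow := Supply.onCells (ball D)) (σ := σ) (D := D)
      (fun c n hc => by simpa [Supply.onCells, mem_ball] using hc) t
    have he := emittedAt_eq (allow := Supply.onCells (ball D)) (σ := σ) t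
    have := h .east; have := h .south; have := h .west; have := h .north
    unfold emittedAt at he
    omega
  · exact findsWithin_of_allow hk hσ
      (fun c n hc _ => by simpa [Supply.onCells, mem_ball] using hc) hx
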